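/- All binary trees are finite and rooted, and each child is a left or a right child; a full binary tree is a non-empty binary tree in which every node has $0$ or $2$ children, and $\bullet$ is the tree with a single node. $|T|$ is the number of nodes of $T$. The random binary search tree $\mathcal B_n$ is defined recursively: $\mathcal B_0$ is empty, and for $n\ge1$ one picks $K$ uniformly in $\{0,\dots,n-1\}$ (the number of items smaller than a uniformly random pivot) and, given $K$, lets the left and right subtrees of the root be independent copies of $\mathcal B_{K}$ and $\mathcal B_{n-1-K}$. The compression $\widehat T$ of a non-empty binary tree $T$ is the full binary tree obtained by contracting all nodes with exactly one child (with $\widehat\emptyset=\emptyset$), and $N_t(T)$ is the number of nodes $v$ of $T$ such that the subtree of $T$ formed by $v$ and its descendants equals $t$. For a full binary tree $t$ put $$G_t(x)=\sum_{T:\ \widehat T=t}\mathbb P(\mathcal B_{|T|}=T)\,x^{|T|} .$$ **Theorem.** (a) For every full binary tree $t$ the series $G_t(x)$ converges absolutely for every real $x$. Moreover $G_\bullet(x)=\tfrac12(e^{2x}-1)$, and if $|t|>1$ and the root of $t$ has left and right subtrees $t_L$ and $t_R$, then for every real $x$ $$G_t(x)=\int_0^x G_{t_L}(y)G_{t_R}(y)e^{2(x-y)}\,dy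 .$$ (b) Put $\hat\beta_\bullet=1/3$ and, if $|t|>1$ and the root of $t$ has left and right subtrees $t_L$ and $t_R$, $$\hat\beta_t=\int_0^1(1-x)^2G_{t_L}(x)G_{t_R}(x)\,dx .$$ Then for every full binary tree $t$, $\hat\beta_t$ is the asymptotic frequency of $t$ in compressed binary search trees: as $n\to\infty$, $N_t(\widehat{\mathcal B_n})/n\to\hat\beta_t$ in probability and $\mathbb E\big[(N_t(\widehat{\mathcal B_n})-n\hat\beta_t)/\sqrt n\big]\to0$. In particular, if for some real $\beta$ and some $\gamma>0$ the variables $(N_t(\widehat{\mathcal B_n})-n\beta)/\sqrt n$ converge in distribution to $N(0,\gamma^2)$, then $\beta=\hat\beta_t$. -/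

import Mathlib

open MeasureTheory ProbabilityTheory Filter Topology
open scoped NNReal ENNReal

namespace CompressedBST

/-- Binary trees (each child is a left or a right child). `nil` is the empty tree, which also
stands for an absent child; the binary trees of the theory are the non-empty ones. -/
abbrev BTree : Type := BinaryTree Unit

/-- The tree with left and right subtrees `l`, `r` (possibly empty). -/
abbrev join (l r : BTree) : BTree := BinaryTree.node () l r

/-- The tree consisting of a root only. -/
abbrev dot : BTree := join BinaryTree.nil BinaryTree.nil

/-- All sets of (countably many) binary trees are measurable. -/
instance instMeasurableSpaceBTree : MeasurableSpace BTree := ⊤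

/-- Full binary trees: non-empty, and every node has outdegree 0 or 2. -/
def IsFull : BTree → Prop
  | .nil => False
  | .node _ .nil .nil => True
  | .node _ l r => IsFull l ∧ IsFull r

/-- The compression of a binary tree: contract all nodes of outdegree 1. -/
def compress : BTree → BTree
  | .nil => .nil
  | .node _ .nil .nil => dot
  | .node _ .nil r => compress r
  | .node _ l .nil => compress l
  | .node _ l r => join (compress l) (compress r)

/-- `fringeCount t T` is the number of nodes `v` of `T` such that the fringe tree of `T` at `v`
(that is, `v` with all its descendants) equals `t`. -/
def fringeCount (t : BTree) : BTree → ℕ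
  | .nil => 0
  | .node _ l r => (if join l r = t then 1 else 0) + fringeCount t l + fringeCount t r

/-- The law of the random binary search tree with `n` nodes, built as in Quicksort. For `n + 1`
items, the pivot is uniformly distributed among them; if it has exactly `k` smaller items, then
these go to the left, the `n - k` larger items go to the right, and the two subtrees are built
independently in the same way. -/
noncomputable def bst : ℕ → PMF BTree
  | 0 => PMF.pure BinaryTree.nil
  | n + 1 =>
    (PMF.uniformOfFintype (Fin (n + 1))).bind fun k =>
      (bst k).bind fun l => (bst (n - k)).bind fun r => PMF.pure (join l r)
termination_by n => n
decreasing_by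
  · exact k.isLt
  · omega

/-- The probability that the random binary search tree with `|T|` nodes equals `T`. -/
noncomputable def bstProb (T : BTree) : ℝ := (bst T.numNodes T).toReal

/-- The set of all binary trees that compress to `t`. -/
def compressTo (t : BTree) : Set BTree := {T | compress T = t}

/-- The generating function `G_t(x) = ∑_T P(BST_{|T|} = T) x ^ |T|`, with `T` ranging over all
binary trees that compress to `t`. -/
noncomputable def G (t : BTree) (x : ℝ) : ℝ :=
  ∑' T : compressTo t, bstProb T * x ^ (T : BTree).numNodes

/-- The number of fringe trees equal to `t` in the compression of `T`, as a real number. With `T`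
distributed as `bst n`, this is the number of fringe trees equal to `t` in the compressed binary
search tree. -/
noncomputable def hatCount (t T : BTree) : ℝ := fringeCount t (compress T)

/-- `b` is the asymptotic fringe tree constant of `t` for the compressed binary search trees.
With `N n` the number of fringe trees equal to `t` in the compressed random binary search tree
with `n` initial nodes: `N n / n → b` in probability; `E [(N n - n * b) / √n] → 0`; and if
`(N n - n * β) / √n` has for some `β` a non-degenerate centred normal limit, then `β` is `b`. -/
structure IsFringeConstant (t : BTree) (b : ℝ) : Prop where
  tendsto_in_probability : ∀ ε : ℝ, 0 < ε →
    Tendsto (fun n : ℕ => (bst n).toMeasure {T | ε ≤ |hatCount t T / n - b|}) atTop (𝓝 0)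
  tendsto_mean :
    Tendsto (fun n : ℕ => ∫ T, (hatCount t T - n * b) / √(n : ℝ) ∂(bst n).toMeasure) atTop (𝓝 0)
  eq_of_normal_limit : ∀ (β : ℝ) (v : ℝ≥0), v ≠ 0 →
    TendstoInDistribution (fun (n : ℕ) (T : BTree) => (hatCount t T - n * β) / √(n : ℝ)) atTop
      (id : ℝ → ℝ) (fun n => (bst n).toMeasure) (gaussianReal 0 v) →
    β = b

end CompressedBST

/-! The count of fringe trees equal to `t` in the compression is an additive functional of the
uncompressed tree: its toll at the root is 1 when the root is not contracted and its compressed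
subtree is `t`, and 0 otherwise (`hatCount_join`).

For any additive functional with a toll in [0, 1], the mean satisfies the Quicksort recurrence,
whose explicit solution is linear in n up to an error of at most 3 (`abs_expect_additive_sub_le`).
Since the two root subtrees are independent given their sizes, the centred second moment satisfies
the same recurrence with an O(n) toll, hence is O(n log n) (`expect_sq_centered_le`). Chebyshev's
inequality gives convergence in probability, the bounded error gives the convergence of means, and a
normal limit with another centring would lose all its mass to infinity
(`eq_of_tendstoInDistribution`).

It remains to identify the growth rate. Conditioning on the root turns the probabilities of
compressing to `t` into a first-order recurrence, that is, the differential equation G' = 2G + Q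
with G(0) = 0 (`compressProb_succ`, `hasDerivAt_G`). Here Q is the product of the two subtree
functions, or 1 for `dot`; variation of constants gives the integral recursion. The growth rate
weights the coefficients of Q by 2 / ((n+1)(n+2)(n+3)), the Beta integral of (1-x)^2 x^n, and
summing under the integral gives the formula (`tollRate_eq_integral`). -/

namespace CompressedBST

open Finset BinaryTree

/-! ### Point probabilities of the random binary search tree -/

section Law

theorem bst_zero : bst 0 = PMF.pure BinaryTree.nil := by rw [bst]

theorem bst_succ (n : ℕ) : bst (n + 1) = (PMF.uniformOfFintype (Fin (n + 1))).bind fun k =>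
    (bst k).bind fun l => (bst (n - k)).bind fun r => PMF.pure (join l r) := by rw [bst]

theorem bst_succ_nil (n : ℕ) : bst (n + 1) BinaryTree.nil = 0 := by
  rw [bst_succ]
  simp [PMF.bind_apply, PMF.pure_apply]

theorem bst_succ_join (n : ℕ) (l r : BTree) :
    bst (n + 1) (join l r) = ∑ k : Fin (n + 1), ((n : ℝ≥0∞) + 1)⁻¹ * (bst k l * bst (n - k) r) := by
  rw [bst_succ, PMF.bind_apply, tsum_fintype]
  refine Finset.sum_congr rfl fun k _ => ?_
  rw [PMF.bind_apply, tsum_eq_single l, PMF.bind_apply, tsum_eq_single r]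
  · simp [PMF.pure_apply]
  · intro r' hr'
    simp [PMF.pure_apply, Ne.symm hr']
  · intro l' hl'
    simp [PMF.bind_apply, PMF.pure_apply, Ne.symm hl']

theorem bst_apply_eq_zero {n : ℕ} {T : BTree} (h : T.numNodes ≠ n) : bst n T = 0 := by
  induction T generalizing n with
  | nil =>
    cases n with
    | zero => simp at h
    | succ n => exact bst_succ_nil n
  | node _ l r ihl ihr =>
    cases n with
    | zero => simp [bst_zero, PMF.pure_apply]
    | succ n =>
      rw [show BinaryTree.node _ l r = join l r from rfl, bst_succ_join]
      refine Finset.sum_eq_zero fun k _ => ?_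
      by_cases hl : l.numNodes = k
      · have hr : r.numNodes ≠ n - k := by
          intro hr
          apply h
          have := k.isLt
          simp only [BinaryTree.numNodes]
          omega
        simp [ihr hr]
      · simp [ihl hl]

theorem bstProb_nil : bstProb BinaryTree.nil = 1 := by
  simp [bstProb, bst_zero, PMF.pure_apply]

theorem bstProb_nonneg (T : BTree) : 0 ≤ bstProb T := ENNReal.toReal_nonneg

/-- The law of each subtree is carried by trees of the prescribed size, so a single pivot rank
contributes. -/
theorem bstProb_join (l r : BTree) :
    bstProb (join l r) = bstProb l * bstProb r / ((l.numNodes + r.numNodes : ℕ) + 1) := by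
  have hk : l.numNodes < l.numNodes + r.numNodes + 1 := by omega
  rw [bstProb, show (join l r).numNodes = l.numNodes + r.numNodes + 1 from rfl, bst_succ_join,
    Finset.sum_eq_single (⟨l.numNodes, hk⟩ : Fin _)]
  · simp only [Nat.add_sub_cancel_left, ENNReal.toReal_mul, ENNReal.toReal_inv]
    rw [ENNReal.toReal_add (by simp) (by simp)]
    simp only [ENNReal.toReal_natCast, ENNReal.toReal_one, bstProb]
    rw [div_eq_inv_mul]
  · intro k _ hne
    have : l.numNodes ≠ k := fun h => hne (Fin.ext h.symm)
    simp [bst_apply_eq_zero this]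
  · simp

end Law

/-! ### Expectations as finite sums, and conditioning on the root -/

section Expectation

/-- The expectation of `f` under `bst n`, as a finite sum. -/
noncomputable def expect (n : ℕ) (f : BTree → ℝ) : ℝ :=
  ∑ T ∈ treesOfNumNodesEq n, bstProb T * f T

theorem ae_mem_treesOfNumNodesEq (n : ℕ) : ∀ᵐ T ∂(bst n).toMeasure, T ∈ treesOfNumNodesEq n := by
  rw [ae_iff, PMF.toMeasure_apply_eq_zero_iff _ (MeasurableSet.of_discrete)]
  rw [Set.disjoint_left]
  intro T hT hT'
  simp only [mem_treesOfNumNodesEq, Set.mem_ofPred_eq] at hT'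
  exact (PMF.mem_support_iff _ _).1 hT (bst_apply_eq_zero hT')

theorem integrable_bst (n : ℕ) (f : BTree → ℝ) : Integrable f (bst n).toMeasure := by
  refine Integrable.of_bound (C := ∑ T ∈ treesOfNumNodesEq n, ‖f T‖)
    (Measurable.of_discrete).aestronglyMeasurable ?_
  filter_upwards [ae_mem_treesOfNumNodesEq n] with T hT
  exact Finset.single_le_sum (f := fun T => ‖f T‖) (fun _ _ => norm_nonneg _) hT

theorem integral_bst (n : ℕ) (f : BTree → ℝ) : ∫ T, f T ∂(bst n).toMeasure = expect n f := by
  rw [PMF.integral_eq_tsum _ _ (integrable_bst n f), expect,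
    tsum_eq_sum (s := treesOfNumNodesEq n)]
  · refine Finset.sum_congr rfl fun T hT => ?_
    rw [mem_treesOfNumNodesEq] at hT
    rw [bstProb, hT, smul_eq_mul]
  · intro T hT
    rw [mem_treesOfNumNodesEq] at hT
    simp [bst_apply_eq_zero hT]

theorem expect_one (n : ℕ) : expect n (fun _ => 1) = 1 := by
  rw [← integral_bst]; simp

theorem expect_zero_left (f : BTree → ℝ) : expect 0 f = f .nil := by
  simp [expect, bstProb_nil]

theorem expect_mono {n : ℕ} {f g : BTree → ℝ} (h : ∀ T, T.numNodes = n → f T ≤ g T) :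
    expect n f ≤ expect n g := by
  refine Finset.sum_le_sum fun T hT => ?_
  exact mul_le_mul_of_nonneg_left (h T (mem_treesOfNumNodesEq.1 hT)) (bstProb_nonneg T)

theorem expect_nonneg {n : ℕ} {f : BTree → ℝ} (h : ∀ T, 0 ≤ f T) : 0 ≤ expect n f :=
  Finset.sum_nonneg fun T _ => mul_nonneg (bstProb_nonneg T) (h T)

theorem expect_congr {n : ℕ} {f g : BTree → ℝ} (h : ∀ T, T.numNodes = n → f T = g T) :
    expect n f = expect n g :=
  le_antisymm (expect_mono fun T hT => (h T hT).le) (expect_mono fun T hT => (h T hT).ge)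

theorem expect_add (n : ℕ) (f g : BTree → ℝ) :
    expect n (fun T => f T + g T) = expect n f + expect n g := by
  simp [expect, mul_add, Finset.sum_add_distrib]

theorem expect_const_mul (n : ℕ) (c : ℝ) (f : BTree → ℝ) :
    expect n (fun T => c * f T) = c * expect n f := by
  simp only [expect, Finset.mul_sum]
  exact Finset.sum_congr rfl fun T _ => by ring

theorem expect_mul_const (n : ℕ) (c : ℝ) (f : BTree → ℝ) :
    expect n (fun T => f T * c) = expect n f * c := by
  simp only [expect, Finset.sum_mul]
  exact Finset.sum_congr rfl fun T _ => by ring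

theorem expect_const (n : ℕ) (c : ℝ) : expect n (fun _ => c) = c := by
  simpa [expect_one] using expect_const_mul n c fun _ => 1

theorem expect_sub (n : ℕ) (f g : BTree → ℝ) :
    expect n (fun T => f T - g T) = expect n f - expect n g := by
  simp [expect, mul_sub, Finset.sum_sub_distrib]

theorem sum_treesOfNumNodesEq_succ (n : ℕ) (f : BTree → ℝ) :
    ∑ T ∈ treesOfNumNodesEq (n + 1), f T = ∑ ij ∈ antidiagonal n,
      ∑ l ∈ treesOfNumNodesEq ij.1, ∑ r ∈ treesOfNumNodesEq ij.2, f (join l r) := by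
  rw [treesOfNumNodesEq_succ, Finset.sum_biUnion]
  · refine Finset.sum_congr rfl fun ij _ => ?_
    rw [Finset.sum_map, Finset.sum_product]
    rfl
  · simp_rw [Set.PairwiseDisjoint, Set.Pairwise, Finset.disjoint_left]
    aesop

/-- The Quicksort recursion: average over the sizes of the two subtrees, which are independent. -/
theorem expect_succ (n : ℕ) (f : BTree → ℝ) :
    expect (n + 1) f = (∑ ij ∈ antidiagonal n,
      expect ij.1 fun l => expect ij.2 fun r => f (join l r)) / (n + 1) := by
  rw [expect, sum_treesOfNumNodesEq_succ, Finset.sum_div]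
  refine Finset.sum_congr rfl fun ij hij => ?_
  simp only [expect, Finset.sum_div, Finset.mul_sum]
  refine Finset.sum_congr rfl fun l hl => Finset.sum_congr rfl fun r hr => ?_
  rw [mem_treesOfNumNodesEq] at hl hr
  rw [HasAntidiagonal.mem_antidiagonal] at hij
  rw [bstProb_join, hl, hr, hij]
  ring

theorem sum_antidiagonal_fst_add_snd (n : ℕ) (a : ℕ → ℝ) :
    ∑ ij ∈ antidiagonal n, (a ij.1 + a ij.2) = 2 * ∑ k ∈ range (n + 1), a k := by
  rw [Finset.sum_add_distrib, Finset.Nat.sum_antidiagonal_eq_sum_range_succ (fun i _ => a i),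
    ← Finset.Nat.sum_antidiagonal_swap]
  simp only [Prod.snd_swap]
  rw [Finset.Nat.sum_antidiagonal_eq_sum_range_succ (fun i _ => a i)]
  ring

end Expectation

/-! ### Explicit solution of the Quicksort recurrence -/

section Recurrence

/-- The partial sums A satisfy A(n+1) = (1 + 2/n) A(n) + b(n) for n ≥ 1; dividing by (n+1)(n+2)
makes this telescope. -/
theorem sum_range_of_quicksort_recurrence {a b : ℕ → ℝ} (h0 : a 0 = b 0)
    (h : ∀ n, a (n + 1) = b (n + 1) + 2 * (∑ k ∈ range (n + 1), a k) / (n + 1)) (n : ℕ) :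
    ∑ k ∈ range n, a k = n * (n + 1) * ∑ k ∈ range n, b k / ((k + 1) * (k + 2)) := by
  induction n with
  | zero => simp
  | succ n ih =>
    rw [Finset.sum_range_succ, Finset.sum_range_succ]
    cases n with
    | zero => simp [h0]; ring
    | succ n =>
      rw [h n, ih]
      push_cast
      field_simp
      ring

theorem eq_of_quicksort_recurrence {a b : ℕ → ℝ} (h0 : a 0 = b 0)
    (h : ∀ n, a (n + 1) = b (n + 1) + 2 * (∑ k ∈ range (n + 1), a k) / (n + 1)) (n : ℕ) :
    a n = b n + 2 * (n + 1) * ∑ k ∈ range n, b k / ((k + 1) * (k + 2)) := by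
  cases n with
  | zero => simp [h0]
  | succ n =>
    rw [h n, sum_range_of_quicksort_recurrence h0 h (n + 1)]
    push_cast
    field_simp

theorem hasSum_inv_mul_succ_shift (n : ℕ) :
    HasSum (fun k : ℕ => 1 / (((k + n : ℕ) + 1 : ℝ) * ((k + n : ℕ) + 2))) (1 / (n + 1)) := by
  have key : ∀ N : ℕ, ∑ k ∈ range N, 1 / (((k + n : ℕ) + 1 : ℝ) * ((k + n : ℕ) + 2)) =
      1 / (n + 1) - 1 / ((N : ℝ) + (n + 1)) := by
    intro N
    induction N with
    | zero => simp
    | succ N ih =>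
      rw [Finset.sum_range_succ, ih]
      push_cast
      have : (N : ℝ) + n + 1 ≠ 0 := by positivity
      field_simp
      ring
  rw [hasSum_iff_tendsto_nat_of_nonneg (fun k => by positivity)]
  simp_rw [key]
  have : Tendsto (fun N : ℕ => 1 / ((N : ℝ) + (n + 1))) atTop (𝓝 0) := by
    simp_rw [one_div]
    exact tendsto_inv_atTop_zero.comp
      (tendsto_atTop_add_const_right _ _ tendsto_natCast_atTop_atTop)
  simpa using tendsto_const_nhds.sub this

end Recurrence

/-! ### Additive functionals: mean, second moment, law of large numbers -/

section AdditiveFunctional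

/-- The mean of the toll function `c` at the root of the random binary search tree. -/
noncomputable def tollMean (c : BTree → BTree → ℝ) : ℕ → ℝ
  | 0 => 0
  | n + 1 => (∑ ij ∈ antidiagonal n, expect ij.1 fun l => expect ij.2 fun r => c l r) / (n + 1)

/-- The linear growth rate of the mean of the additive functional with toll function `c`. -/
noncomputable def tollRate (c : BTree → BTree → ℝ) : ℝ :=
  2 * ∑' k : ℕ, tollMean c k / ((k + 1) * (k + 2))

/-- `F` is the additive functional on binary trees with the `[0, 1]`-valued toll function `c`. -/
structure IsAdditive (F : BTree → ℝ) (c : BTree → BTree → ℝ) : Prop where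
  nil : F .nil = 0
  join : ∀ l r, F (join l r) = c l r + F l + F r
  nonneg : ∀ l r, 0 ≤ c l r
  le_one : ∀ l r, c l r ≤ 1

variable {F : BTree → ℝ} {c : BTree → BTree → ℝ}

theorem sum_antidiagonal_expect_fst_add_snd (n : ℕ) (f : BTree → ℝ) :
    ∑ ij ∈ antidiagonal n, (expect ij.1 fun l => expect ij.2 fun r => f l + f r) =
      2 * ∑ k ∈ range (n + 1), expect k f := by
  rw [← sum_antidiagonal_fst_add_snd]
  refine Finset.sum_congr rfl fun ij _ => ?_
  simp [expect_add, expect_const]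

theorem tollMean_nonneg (h : IsAdditive F c) (n : ℕ) : 0 ≤ tollMean c n := by
  cases n with
  | zero => exact le_rfl
  | succ n =>
    exact div_nonneg (Finset.sum_nonneg fun ij _ => expect_nonneg fun l => expect_nonneg fun r =>
      h.nonneg l r) (by positivity)

theorem tollMean_le_one (h : IsAdditive F c) (n : ℕ) : tollMean c n ≤ 1 := by
  cases n with
  | zero => exact zero_le_one
  | succ n =>
    rw [tollMean, div_le_one (by positivity)]
    calc _ ≤ ∑ ij ∈ antidiagonal n, (1 : ℝ) := by
          refine Finset.sum_le_sum fun ij _ => ?_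
          rw [← expect_const ij.1 1]
          refine expect_mono fun l _ => ?_
          rw [← expect_const ij.2 1]
          exact expect_mono fun r _ => h.le_one l r
      _ = n + 1 := by simp

theorem summable_tollMean (h : IsAdditive F c) :
    Summable fun k : ℕ => tollMean c k / ((k + 1) * (k + 2)) := by
  refine Summable.of_nonneg_of_le (fun k => div_nonneg (tollMean_nonneg h k) (by positivity))
    (fun k => ?_) (hasSum_inv_mul_succ_shift 0).summable
  exact div_le_div_of_nonneg_right (tollMean_le_one h k) (by positivity)

theorem tsum_tollMean_shift_nonneg (h : IsAdditive F c) (n : ℕ) :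
    0 ≤ ∑' k : ℕ, tollMean c (k + n) / (((k + n : ℕ) + 1) * ((k + n : ℕ) + 2)) :=
  tsum_nonneg fun k => div_nonneg (tollMean_nonneg h _) (by positivity)

theorem tsum_tollMean_shift_le (h : IsAdditive F c) (n : ℕ) :
    ∑' k : ℕ, tollMean c (k + n) / (((k + n : ℕ) + 1) * ((k + n : ℕ) + 2)) ≤ 1 / (n + 1) := by
  rw [← (hasSum_inv_mul_succ_shift n).tsum_eq]
  refine Summable.tsum_le_tsum (fun k => ?_)
    ((summable_nat_add_iff n).2 (summable_tollMean h)) (hasSum_inv_mul_succ_shift n).summable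
  exact div_le_div_of_nonneg_right (tollMean_le_one h _) (by positivity)

theorem tollRate_nonneg (h : IsAdditive F c) : 0 ≤ tollRate c := by
  have := tsum_tollMean_shift_nonneg h 0
  simp only [add_zero] at this
  rw [tollRate]; linarith

theorem tollRate_le_two (h : IsAdditive F c) : tollRate c ≤ 2 := by
  have := tsum_tollMean_shift_le h 0
  simp only [add_zero, Nat.cast_zero, zero_add, div_one] at this
  rw [tollRate]; linarith

theorem expect_additive_succ (h : IsAdditive F c) (n : ℕ) :
    expect (n + 1) F =
      tollMean c (n + 1) + 2 * (∑ k ∈ range (n + 1), expect k F) / (n + 1) := by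
  rw [expect_succ, tollMean, ← sum_antidiagonal_expect_fst_add_snd, ← add_div,
    ← Finset.sum_add_distrib]
  congr 1
  refine Finset.sum_congr rfl fun ij _ => ?_
  rw [← expect_add]
  refine expect_congr fun l _ => ?_
  rw [← expect_add]
  exact expect_congr fun r _ => by rw [h.join]; ring

theorem abs_expect_additive_sub_le (h : IsAdditive F c) (n : ℕ) :
    |expect n F - n * tollRate c| ≤ 3 := by
  have hF := eq_of_quicksort_recurrence (a := fun n => expect n F) (b := tollMean c)
    (by simp [expect_zero_left, h.nil, tollMean]) (expect_additive_succ h) n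
  have hs := (summable_tollMean h).sum_add_tsum_nat_add n
  set S := ∑ k ∈ range n, tollMean c k / (((k : ℝ) + 1) * (k + 2))
  set R := ∑' k : ℕ, tollMean c (k + n) / (((k + n : ℕ) + 1 : ℝ) * ((k + n : ℕ) + 2))
  have hβ : tollRate c = 2 * (S + R) := by rw [tollRate, ← hs]
  have hR0 : 0 ≤ R := tsum_tollMean_shift_nonneg h n
  have hR1 : (n + 1) * R ≤ 1 := by
    have : R ≤ 1 / (n + 1) := tsum_tollMean_shift_le h n
    rwa [le_div_iff₀ (by positivity), mul_comm] at this
  have hR2 : 0 ≤ (n + 1) * R := by positivity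
  have h1 := tollRate_nonneg h
  have h2 := tollRate_le_two h
  have h3 := tollMean_nonneg h n
  have h4 := tollMean_le_one h n
  -- The exact solution involves the partial sum S and the rate involves the full series S + R, so
  -- only the tail R survives, and (n+1) R ≤ 1.
  have key : expect n F - n * tollRate c = tollMean c n + tollRate c - 2 * ((n + 1) * R) := by
    rw [hF, hβ]; ring
  rw [key, abs_le]
  constructor <;> linarith

theorem additive_nonneg (h : IsAdditive F c) (T : BTree) : 0 ≤ F T := by
  induction T with
  | nil => exact h.nil.ge
  | node _ l r ihl ihr =>
    rw [show BinaryTree.node _ l r = join l r from rfl, h.join]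
    linarith [h.nonneg l r]

theorem additive_le_numNodes (h : IsAdditive F c) (T : BTree) : F T ≤ T.numNodes := by
  induction T with
  | nil => simp [h.nil]
  | node _ l r ihl ihr =>
    rw [show BinaryTree.node _ l r = join l r from rfl, h.join]
    simp only [BinaryTree.numNodes]
    push_cast
    linarith [h.le_one l r]

theorem abs_additive_sub_le (h : IsAdditive F c) (T : BTree) :
    |F T - T.numNodes * tollRate c| ≤ 2 * T.numNodes := by
  have h1 := tollRate_nonneg h
  have h2 := tollRate_le_two h
  have h3 := additive_nonneg h T
  have h4 := additive_le_numNodes h T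
  have h5 : (0 : ℝ) ≤ T.numNodes := by positivity
  have h6 := mul_nonneg h5 h1
  have h7 := mul_le_mul_of_nonneg_left h2 h5
  rw [abs_le]
  constructor <;> linarith

theorem abs_expect_centered_le (h : IsAdditive F c) (n : ℕ) :
    |expect n fun T => F T - T.numNodes * tollRate c| ≤ 3 := by
  have : (expect n fun T => F T - T.numNodes * tollRate c) = expect n F - n * tollRate c := by
    rw [expect_congr (g := fun T => F T - n * tollRate c) fun T hT => by rw [hT], expect_sub,
      expect_const]
  rw [this]
  exact abs_expect_additive_sub_le h n

/-- Expand the square at the root. Given the sizes, the subtrees are independent, so the cross term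
is a product of two centred means, each at most 3 in absolute value; all else beyond the two squares
is O(n). -/
theorem expect_sq_centered_succ_le (h : IsAdditive F c) (n : ℕ) :
    (expect (n + 1) fun T => (F T - T.numNodes * tollRate c) ^ 2) ≤ 22 * (n + 2) +
      2 * (∑ k ∈ range (n + 1), expect k fun T => (F T - T.numNodes * tollRate c) ^ 2) /
        (n + 1) := by
  set X : BTree → ℝ := fun T => F T - T.numNodes * tollRate c with hX
  have hXb : ∀ T, |X T| ≤ 2 * T.numNodes := abs_additive_sub_le h
  have hXm : ∀ k, |expect k X| ≤ 3 := abs_expect_centered_le h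
  have step : ∀ l r, l.numNodes + r.numNodes = n →
      X (join l r) ^ 2 ≤ (X l ^ 2 + X r ^ 2) + ((8 * n + 4) + 2 * X l * X r) := by
    intro l r hn
    have hj : X (join l r) = (c l r - tollRate c) + (X l + X r) := by
      simp only [hX, h.join, BinaryTree.numNodes]
      push_cast
      ring
    have ha : |c l r - tollRate c| ≤ 2 := by
      have h1 := tollRate_nonneg h
      have h2 := tollRate_le_two h
      rw [abs_le]
      constructor <;> linarith [h.nonneg l r, h.le_one l r]
    have hb : |X l + X r| ≤ 2 * n := by
      refine (abs_add_le _ _).trans ?_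
      rw [← hn]
      push_cast
      linarith [hXb l, hXb r]
    have hab : (c l r - tollRate c) * (X l + X r) ≤ 2 * (2 * n) := by
      refine (le_abs_self _).trans ?_
      rw [abs_mul]
      exact mul_le_mul ha hb (abs_nonneg _) (by norm_num)
    have ha2 : (c l r - tollRate c) ^ 2 ≤ 2 ^ 2 := sq_le_sq' (by linarith [(abs_le.1 ha).1])
      (abs_le.1 ha).2
    rw [hj]
    linarith
  have hsum : (∑ ij ∈ antidiagonal n, expect ij.1 fun l => expect ij.2 fun r =>
      X (join l r) ^ 2) ≤ 22 * (n + 2) * (n + 1) +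
        2 * ∑ k ∈ range (n + 1), expect k fun T => X T ^ 2 := by
    rw [← sum_antidiagonal_expect_fst_add_snd]
    -- Each summand has excess at most 8n + 4 + 2·9 = 8n + 22. The cruder 22(n+2) later cancels a
    -- factor of the denominator (k+1)(k+2).
    have hc : (22 * (n + 2) * (n + 1) : ℝ) = ∑ ij ∈ antidiagonal n, (22 * (n + 2) : ℝ) := by
      simp; ring
    rw [hc, ← Finset.sum_add_distrib]
    refine Finset.sum_le_sum fun ij hij => ?_
    rw [HasAntidiagonal.mem_antidiagonal] at hij
    have h1 : (expect ij.1 fun l => expect ij.2 fun r => X (join l r) ^ 2) ≤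
        expect ij.1 fun l => expect ij.2 fun r =>
          (X l ^ 2 + X r ^ 2) + ((8 * n + 4) + 2 * X l * X r) :=
      expect_mono fun l hl => expect_mono fun r hr => step l r (by omega)
    refine h1.trans ?_
    simp only [expect_add, expect_const, expect_const_mul, expect_mul_const]
    have h2 : expect ij.1 X * expect ij.2 X ≤ 3 * 3 := by
      refine (le_abs_self _).trans ?_
      rw [abs_mul]
      exact mul_le_mul (hXm _) (hXm _) (abs_nonneg _) (by norm_num)
    have h3 : (0 : ℝ) ≤ n := by positivity
    linarith
  rw [expect_succ, div_le_iff₀ (by positivity), add_mul, div_mul_cancel₀ _ (by positivity)]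
  exact hsum

theorem expect_sq_centered_le (h : IsAdditive F c) (n : ℕ) :
    (expect n fun T => (F T - T.numNodes * tollRate c) ^ 2) ≤
      44 * (n + 1) * (1 + ∑ k ∈ range n, 1 / ((k : ℝ) + 2)) := by
  set s : ℕ → ℝ := fun n => expect n fun T => (F T - T.numNodes * tollRate c) ^ 2 with hs
  -- Taking the defect as toll turns the inequality into an exact recurrence, whose solution is
  -- monotone in the toll. At n = 0 the quotient is 0, so b 0 = s 0.
  set b : ℕ → ℝ := fun n => s n - 2 * (∑ k ∈ range n, s k) / n with hb
  have hb' : ∀ n, b n ≤ 22 * (n + 1) := by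
    intro n
    cases n with
    | zero => simp [hb, hs, expect_zero_left, h.nil]
    | succ n =>
      have := expect_sq_centered_succ_le h n
      simp only [hb]
      push_cast
      linarith
  change s n ≤ _
  rw [eq_of_quicksort_recurrence (a := s) (b := b) (by simp [hb])
    (fun n => by simp only [hb]; push_cast; ring) n]
  have hsum : ∑ k ∈ range n, b k / ((k + 1) * (k + 2)) ≤
      22 * ∑ k ∈ range n, 1 / ((k : ℝ) + 2) := by
    rw [Finset.mul_sum]
    refine Finset.sum_le_sum fun k _ => ?_
    rw [div_le_iff₀ (by positivity)]
    refine (hb' k).trans (le_of_eq ?_)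
    field_simp
  have hm := mul_le_mul_of_nonneg_left hsum (show (0 : ℝ) ≤ 2 * (n + 1) by positivity)
  have := hb' n
  have h0 : (0 : ℝ) ≤ n := by positivity
  linarith

theorem tendsto_expect_sq_centered (h : IsAdditive F c) :
    Tendsto (fun n : ℕ => (expect n fun T => (F T - T.numNodes * tollRate c) ^ 2) / (n : ℝ) ^ 2)
      atTop (𝓝 0) := by
  have h1 : Tendsto (fun n : ℕ => (n : ℝ)⁻¹) atTop (𝓝 0) := tendsto_inv_atTop_nhds_zero_nat
  -- No logarithmic bound is needed: this is the Cesàro mean of a null sequence.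
  have h2 : Tendsto (fun n : ℕ => (n : ℝ)⁻¹ * ∑ k ∈ range n, 1 / ((k : ℝ) + 2)) atTop (𝓝 0) := by
    refine Tendsto.cesaro ?_
    simp_rw [one_div]
    exact tendsto_inv_atTop_zero.comp
      (tendsto_atTop_add_const_right _ _ tendsto_natCast_atTop_atTop)
  have h3 : Tendsto (fun n : ℕ => 44 * (1 + (n : ℝ)⁻¹) *
      ((n : ℝ)⁻¹ + (n : ℝ)⁻¹ * ∑ k ∈ range n, 1 / ((k : ℝ) + 2))) atTop (𝓝 0) := by
    simpa using ((h1.const_add 1).const_mul 44).mul (h1.add h2)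
  refine squeeze_zero' (Eventually.of_forall fun n => ?_) ?_ h3
  · exact div_nonneg (expect_nonneg fun T => sq_nonneg _) (sq_nonneg _)
  · filter_upwards [eventually_gt_atTop 0] with n hn
    have hn' : (0 : ℝ) < n := by exact_mod_cast hn
    rw [div_le_iff₀ (by positivity)]
    refine (expect_sq_centered_le h n).trans (le_of_eq ?_)
    field_simp

theorem toMeasure_le_expect_sq (n : ℕ) (X : BTree → ℝ) {ε : ℝ} (hε : 0 < ε) :
    (bst n).toMeasure {T | ε ≤ |X T|} ≤
      ENNReal.ofReal ((expect n fun T => X T ^ 2) / ε ^ 2) := by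
  have h := mul_meas_ge_le_integral_of_nonneg (μ := (bst n).toMeasure) (f := fun T => X T ^ 2)
    (Eventually.of_forall fun T => sq_nonneg _) (integrable_bst n _) (ε ^ 2)
  rw [integral_bst, mul_comm, ← le_div_iff₀ (by positivity)] at h
  have hset : {T | ε ≤ |X T|} = {T | ε ^ 2 ≤ X T ^ 2} := by
    ext T
    simp only [Set.mem_ofPred_eq]
    rw [← sq_abs (X T)]
    exact (pow_le_pow_iff_left₀ hε.le (abs_nonneg _) two_ne_zero).symm
  rw [hset, ← ofReal_measureReal]
  exact ENNReal.ofReal_le_ofReal h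

theorem tendsto_in_probability_additive (h : IsAdditive F c) {ε : ℝ} (hε : 0 < ε) :
    Tendsto (fun n : ℕ => (bst n).toMeasure {T | ε ≤ |F T / n - tollRate c|}) atTop (𝓝 0) := by
  have h1 : Tendsto (fun n : ℕ => ENNReal.ofReal
      ((expect n fun T => (F T - T.numNodes * tollRate c) ^ 2) / (n : ℝ) ^ 2 / ε ^ 2))
      atTop (𝓝 0) := by
    have := ENNReal.tendsto_ofReal ((tendsto_expect_sq_centered h).div_const (ε ^ 2))
    simpa using this
  refine tendsto_of_tendsto_of_tendsto_of_le_of_le' tendsto_const_nhds h1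
    (Eventually.of_forall fun _ => zero_le) ?_
  filter_upwards [eventually_gt_atTop 0] with n hn
  have hn' : (n : ℝ) ≠ 0 := by positivity
  refine (toMeasure_le_expect_sq n _ hε).trans (le_of_eq ?_)
  congr 2
  rw [div_eq_mul_inv, ← expect_mul_const]
  refine expect_congr fun T hT => ?_
  rw [hT]
  field_simp

theorem tendsto_mean_additive (h : IsAdditive F c) :
    Tendsto (fun n : ℕ => ∫ T, (F T - n * tollRate c) / √(n : ℝ) ∂(bst n).toMeasure)
      atTop (𝓝 0) := by
  have h1 : Tendsto (fun n : ℕ => 3 * (√(n : ℝ))⁻¹) atTop (𝓝 0) := by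
    have : Tendsto (fun n : ℕ => (√(n : ℝ))⁻¹) atTop (𝓝 0) :=
      tendsto_inv_atTop_zero.comp (Real.tendsto_sqrt_atTop.comp tendsto_natCast_atTop_atTop)
    simpa using this.const_mul 3
  refine squeeze_zero_norm (fun n => ?_) h1
  simp_rw [integral_bst, div_eq_mul_inv]
  rw [expect_mul_const, expect_sub, expect_const, norm_mul, Real.norm_eq_abs, norm_inv,
    Real.norm_of_nonneg (Real.sqrt_nonneg _)]
  exact mul_le_mul_of_nonneg_right (abs_expect_additive_sub_le h n) (by positivity)

end AdditiveFunctional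

/-! ### Uniqueness of the centring under a limit law -/

section NormalLimit

/-- If β ≠ b, then F/n being close to b forces the normalised variable to have size at least of
order √n. By the portmanteau theorem the limit gives mass 0 to every bounded interval, which no
probability measure does; normality plays no role. -/
theorem eq_of_tendstoInDistribution {F : BTree → ℝ} {b β : ℝ} {ν : Measure ℝ}
    [IsProbabilityMeasure ν]
    (hp : ∀ ε : ℝ, 0 < ε →
      Tendsto (fun n : ℕ => (bst n).toMeasure {T | ε ≤ |F T / n - b|}) atTop (𝓝 0))
    (hd : TendstoInDistribution (fun (n : ℕ) (T : BTree) => (F T - n * β) / √(n : ℝ)) atTop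
      (id : ℝ → ℝ) (fun n => (bst n).toMeasure) ν) :
    β = b := by
  by_contra hne
  have hδ : 0 < |β - b| := abs_pos.2 (sub_ne_zero.2 hne)
  have hnull : ∀ R : ℕ, ν {x : ℝ | |x| < R} = 0 := by
    intro R
    have hopen : IsOpen {x : ℝ | |x| < R} := isOpen_lt continuous_abs continuous_const
    have hle := ProbabilityMeasure.le_liminf_measure_open_of_tendsto hd.tendsto hopen
    simp only [ProbabilityMeasure.coe_mk, Measure.map_id] at hle
    refine le_antisymm (hle.trans ?_) zero_le
    rw [← (hp (|β - b| / 2) (by positivity)).liminf_eq]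
    refine liminf_le_liminf ?_
    have hlarge : ∀ᶠ n : ℕ in atTop, (R : ℝ) / (|β - b| / 2) ≤ √(n : ℝ) :=
      (Real.tendsto_sqrt_atTop.comp tendsto_natCast_atTop_atTop).eventually_ge_atTop _
    filter_upwards [hlarge, eventually_gt_atTop 0] with n hn hn0
    rw [Measure.map_apply_of_aemeasurable (hd.forall_aemeasurable n) hopen.measurableSet]
    refine measure_mono fun T hT => ?_
    simp only [Set.mem_preimage, Set.mem_ofPred_eq] at hT ⊢
    have hn' : (0 : ℝ) < n := by exact_mod_cast hn0
    have hs : 0 < √(n : ℝ) := Real.sqrt_pos.2 hn'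
    have hss : √(n : ℝ) * √(n : ℝ) = n := Real.mul_self_sqrt hn'.le
    rw [div_le_iff₀ (by positivity)] at hn
    rw [abs_div, abs_of_pos hs, div_lt_iff₀ hs] at hT
    have h1 : |F T / n - β| ≤ |β - b| / 2 := by
      have : F T / n - β = (F T - n * β) / n := by field_simp
      rw [this, abs_div, abs_of_pos hn', div_le_iff₀ hn']
      have := mul_le_mul_of_nonneg_right hn hs.le
      calc |F T - n * β| ≤ R * √(n : ℝ) := hT.le
        _ ≤ √(n : ℝ) * (|β - b| / 2) * √(n : ℝ) := this
        _ = |β - b| / 2 * n := by rw [← hss]; simp only [Real.sqrt_mul_self hs.le]; ring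
    have h2 : |β - b| ≤ |F T / n - β| + |F T / n - b| := by
      rw [abs_sub_comm (F T / n) β]
      exact abs_sub_le _ _ _
    linarith
  have huniv : (Set.univ : Set ℝ) = ⋃ R : ℕ, {x : ℝ | |x| < R} := by
    ext x
    simpa using exists_nat_gt |x|
  have : ν Set.univ = 0 := by rw [huniv]; exact measure_iUnion_null hnull
  simp at this

end NormalLimit

/-! ### Compression at the root and the toll function -/

section Compression

theorem compress_dot : compress dot = dot := by simp [compress]

theorem compress_join_nil_left {r : BTree} (hr : r ≠ .nil) :
    compress (join .nil r) = compress r := by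
  cases r with
  | nil => exact absurd rfl hr
  | node _ a b => simp [compress]

theorem compress_join_nil_right {l : BTree} (hl : l ≠ .nil) :
    compress (join l .nil) = compress l := by
  cases l with
  | nil => exact absurd rfl hl
  | node _ a b => simp [compress]

theorem compress_join {l r : BTree} (hl : l ≠ .nil) (hr : r ≠ .nil) :
    compress (join l r) = join (compress l) (compress r) := by
  cases l with
  | nil => exact absurd rfl hl
  | node _ a b =>
    cases r with
    | nil => exact absurd rfl hr
    | node _ c d => simp [compress]

theorem compress_eq_nil_iff {T : BTree} : compress T = .nil ↔ T = .nil := by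
  induction T with
  | nil => simp [compress]
  | node _ l r ihl ihr =>
    change compress (join l r) = .nil ↔ join l r = .nil
    by_cases hl : l = .nil <;> by_cases hr : r = .nil
    · subst hl hr; simp [compress]
    · subst hl; simp [compress_join_nil_left hr, ihr, hr]
    · subst hr; simp [compress_join_nil_right hl, ihl, hl]
    · simp [compress_join hl hr]

theorem fringeCount_join (t l r : BTree) : fringeCount t (join l r) =
    (if join l r = t then 1 else 0) + fringeCount t l + fringeCount t r := rfl

/-- The toll function of the number of fringe trees equal to `t` in the compression: the
indicator that the root is not contracted and becomes the root of such a fringe tree. -/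
noncomputable def toll (t l r : BTree) : ℝ :=
  if (l = .nil ↔ r = .nil) ∧ join (compress l) (compress r) = t then 1 else 0

theorem hatCount_join (t l r : BTree) :
    hatCount t (join l r) = toll t l r + hatCount t l + hatCount t r := by
  have hnil : fringeCount t .nil = 0 := rfl
  have cnil : compress .nil = .nil := by simp [compress]
  by_cases hl : l = .nil <;> by_cases hr : r = .nil
  · subst hl hr
    simp [hatCount, toll, compress_dot, fringeCount_join, cnil, hnil]
  · subst hl
    simp [hatCount, toll, compress_join_nil_left hr, hr, cnil, hnil]
  · subst hr
    simp [hatCount, toll, compress_join_nil_right hl, hl, cnil, hnil]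
  · simp [hatCount, toll, compress_join hl hr, hr, hl, fringeCount_join]

theorem isAdditive_hatCount (t : BTree) : IsAdditive (hatCount t) (toll t) where
  nil := by simp [hatCount, compress, fringeCount]
  join := hatCount_join t
  nonneg l r := by unfold toll; split_ifs <;> norm_num
  le_one l r := by unfold toll; split_ifs <;> norm_num

theorem isFringeConstant_tollRate (t : BTree) : IsFringeConstant t (tollRate (toll t)) where
  tendsto_in_probability _ hε := tendsto_in_probability_additive (isAdditive_hatCount t) hε
  tendsto_mean := tendsto_mean_additive (isAdditive_hatCount t)
  eq_of_normal_limit _ _ _ h := eq_of_tendstoInDistribution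
    (fun _ hε => tendsto_in_probability_additive (isAdditive_hatCount t) hε) h

/-- The cases are a root contracted for lack of a left child, one contracted for lack of a right
child, and a root that is kept. For a single node the first two terms vanish because `t` is not
empty. -/
theorem ind_compress_join {t : BTree} (ht : t ≠ .nil) (l r : BTree) :
    (if compress (join l r) = t then (1 : ℝ) else 0) =
      ((if l = .nil then 1 else 0) * (if compress r = t then 1 else 0) +
        (if compress l = t then 1 else 0) * (if r = .nil then 1 else 0)) + toll t l r := by
  have cnil : compress .nil = .nil := by simp [compress]
  by_cases hl : l = .nil <;> by_cases hr : r = .nil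
  · subst hl hr
    simp [toll, compress_dot, cnil, ht.symm]
  · subst hl
    simp [toll, compress_join_nil_left hr, hr]
  · subst hr
    simp [toll, compress_join_nil_right hl, hl]
  · simp [toll, compress_join hl hr, hr, hl]

theorem toll_dot (l r : BTree) :
    toll dot l r = (if l = .nil then 1 else 0) * (if r = .nil then 1 else 0) := by
  by_cases hl : l = .nil <;> by_cases hr : r = .nil <;> simp [toll, compress_eq_nil_iff, hl, hr]

/-- Nonempty targets force both subtrees to be nonempty, so the condition that the root is kept is
automatic and the toll factorises; this is the source of the product of generating functions. -/
theorem toll_join {tL tR : BTree} (hL : tL ≠ .nil) (hR : tR ≠ .nil) (l r : BTree) :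
    toll (join tL tR) l r =
      (if compress l = tL then 1 else 0) * (if compress r = tR then 1 else 0) := by
  by_cases hl : compress l = tL <;> by_cases hr : compress r = tR
  · subst hl hr
    rw [ne_eq, compress_eq_nil_iff] at hL hR
    simp [toll, hL, hR]
  all_goals simp [toll, hl, hr]

theorem IsFull.ne_nil {t : BTree} (h : IsFull t) : t ≠ .nil := by
  rintro rfl
  simp [IsFull] at h

theorem IsFull.rec_on {p : BTree → Prop} (hdot : p dot)
    (hjoin : ∀ l r, IsFull l → IsFull r → p l → p r → p (join l r)) {t : BTree} (ht : IsFull t) :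
    p t := by
  induction t with
  | nil => simp [IsFull] at ht
  | node _ l r ihl ihr =>
    by_cases h : l = .nil ∧ r = .nil
    · obtain ⟨rfl, rfl⟩ := h
      exact hdot
    · have hlr : IsFull l ∧ IsFull r := by
        cases l <;> cases r <;> simp_all [IsFull]
      exact hjoin l r hlr.1 hlr.2 (ihl hlr.1) (ihr hlr.2)

end Compression

/-! ### Recurrences for the coefficients -/

section Coefficients

/-- The coefficients of the generating function of `t`: the probability that the random binary
search tree compresses to `t`. -/
noncomputable def compressProb (t : BTree) (n : ℕ) : ℝ :=
  expect n fun T => if compress T = t then 1 else 0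

/-- The coefficients of the inhomogeneous term in the differential equation of `G t`. -/
noncomputable def tollSum (t : BTree) (n : ℕ) : ℝ :=
  ∑ ij ∈ antidiagonal n, expect ij.1 fun l => expect ij.2 fun r => toll t l r

theorem expect_eq_nil (n : ℕ) :
    (expect n fun T => if T = .nil then 1 else 0) = if n = 0 then 1 else 0 := by
  by_cases hn : n = 0
  · subst hn; simp [expect_zero_left]
  · rw [if_neg hn]
    refine (expect_congr fun T hT => if_neg ?_).trans (expect_const n 0)
    rintro rfl
    exact hn hT.symm

theorem compressProb_zero {t : BTree} (ht : t ≠ .nil) : compressProb t 0 = 0 := by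
  simp [compressProb, expect_zero_left, compress, ht.symm]

/-- This is G' = 2G + Q read coefficientwise; the 2 counts the two sides on which the single child
of a contracted root can lie. -/
theorem compressProb_succ {t : BTree} (ht : t ≠ .nil) (n : ℕ) :
    (n + 1) * compressProb t (n + 1) = 2 * compressProb t n + tollSum t n := by
  rw [compressProb, expect_succ, mul_div_cancel₀ _ (by positivity)]
  simp only [ind_compress_join ht, expect_add, expect_const_mul, expect_mul_const, expect_eq_nil]
  rw [Finset.sum_add_distrib, Finset.sum_add_distrib, ← tollSum]
  change (∑ ij ∈ antidiagonal n, _ * compressProb t _) +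
    (∑ ij ∈ antidiagonal n, compressProb t _ * _) + _ = _
  rw [Finset.sum_eq_single (0, n), Finset.sum_eq_single (n, 0)]
  · simp; ring
  · rintro ⟨i, j⟩ hij hne
    rw [HasAntidiagonal.mem_antidiagonal] at hij
    rw [if_neg, mul_zero]
    rintro rfl
    exact hne (by simp_all)
  · simp
  · rintro ⟨i, j⟩ hij hne
    rw [HasAntidiagonal.mem_antidiagonal] at hij
    rw [if_neg, zero_mul]
    rintro rfl
    exact hne (by simp_all)
  · simp

theorem tollSum_dot (n : ℕ) : tollSum dot n = if n = 0 then 1 else 0 := by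
  simp only [tollSum, toll_dot, expect_const_mul, expect_mul_const, expect_eq_nil]
  by_cases hn : n = 0
  · subst hn; simp
  · rw [if_neg hn]
    refine Finset.sum_eq_zero fun ij hij => ?_
    rw [HasAntidiagonal.mem_antidiagonal] at hij
    by_cases hi : ij.1 = 0
    · rw [if_neg (show ij.2 ≠ 0 by omega), mul_zero]
    · rw [if_neg hi, zero_mul]

theorem tollSum_join {tL tR : BTree} (hL : tL ≠ .nil) (hR : tR ≠ .nil) (n : ℕ) :
    tollSum (join tL tR) n =
      ∑ ij ∈ antidiagonal n, compressProb tL ij.1 * compressProb tR ij.2 := by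
  simp only [tollSum, toll_join hL hR, expect_const_mul, expect_mul_const]
  rfl

theorem tollSum_nonneg (t : BTree) (n : ℕ) : 0 ≤ tollSum t n :=
  Finset.sum_nonneg fun _ _ => expect_nonneg fun l => expect_nonneg fun r =>
    (isAdditive_hatCount t).nonneg l r

theorem tollRate_toll_eq_tsum (t : BTree) :
    tollRate (toll t) = ∑' n : ℕ, tollSum t n * (2 / ((n + 1) * (n + 2) * (n + 3))) := by
  rw [tollRate, (summable_tollMean (isAdditive_hatCount t)).tsum_eq_zero_add]
  simp only [tollMean]
  rw [zero_div, zero_add, ← tsum_mul_left]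
  refine tsum_congr fun n => ?_
  rw [← tollSum]
  push_cast
  field_simp
  ring

end Coefficients

open scoped Nat

/-! ### Entire power series with factorially decaying coefficients -/

section PowerSeries

/-- The coefficients `a n` are `O(S ^ n / n!)`, so that `∑ a n * x ^ n` is entire. -/
def FactorialDecay (a : ℕ → ℝ) : Prop := ∃ S : ℝ, 0 ≤ S ∧ ∀ n, |a n| * n ! ≤ S ^ n

theorem FactorialDecay.summable_norm {a : ℕ → ℝ} (ha : FactorialDecay a) (x : ℝ) :
    Summable fun n => ‖a n * x ^ n‖ := by
  obtain ⟨S, hS, h⟩ := ha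
  refine Summable.of_nonneg_of_le (fun n => norm_nonneg _) (fun n => ?_)
    (Real.summable_pow_div_factorial (S * |x|))
  rw [norm_mul, norm_pow, Real.norm_eq_abs, Real.norm_eq_abs, mul_pow, mul_div_right_comm]
  refine mul_le_mul_of_nonneg_right ?_ (by positivity)
  rw [le_div_iff₀ (by positivity)]
  exact h n

theorem FactorialDecay.hasDerivAt {a : ℕ → ℝ} (ha : FactorialDecay a) (x : ℝ) :
    HasDerivAt (fun y => ∑' n, a n * y ^ n) (∑' n : ℕ, (n + 1) * a (n + 1) * x ^ n) x := by
  obtain ⟨S, hS, h⟩ := ha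
  -- Any radius larger than |x| gives a ball around 0 containing x on which the termwise derivatives
  -- are uniformly dominated.
  set R : ℝ := |x| + 1 with hR
  have hu : Summable fun n : ℕ => |a n| * (n * R ^ (n - 1)) := by
    rw [← summable_nat_add_iff 1]
    refine Summable.of_nonneg_of_le (fun n => by positivity) (fun n => ?_)
      ((Real.summable_pow_div_factorial (S * R)).mul_left S)
    have h1 := h (n + 1)
    rw [Nat.factorial_succ] at h1
    push_cast at h1
    rw [Nat.add_sub_cancel, ← mul_assoc, mul_pow, ← mul_div_assoc, ← mul_assoc,
      mul_div_right_comm]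
    refine mul_le_mul_of_nonneg_right ?_ (by positivity)
    rw [le_div_iff₀ (by positivity), ← pow_succ']
    push_cast
    linarith
  have hx : x ∈ Metric.ball (0 : ℝ) R := by simp [hR]
  have key := hasDerivAt_tsum_of_isPreconnected (g := fun n (y : ℝ) => a n * y ^ n)
    (g' := fun n (y : ℝ) => a n * (n * y ^ (n - 1))) hu Metric.isOpen_ball
    (convex_ball (0 : ℝ) R).isPreconnected (fun n y _ => (hasDerivAt_pow n y).const_mul (a n))
    (fun n y hy => ?_) hx (FactorialDecay.summable_norm ⟨S, hS, h⟩ x).of_norm hx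
  · convert! key using 1
    have hs : Summable fun n : ℕ => a n * (n * x ^ (n - 1)) := by
      refine Summable.of_norm_bounded hu fun n => ?_
      rw [norm_mul, norm_mul, norm_pow, Real.norm_eq_abs, Real.norm_eq_abs, Real.norm_eq_abs,
        Nat.abs_cast]
      gcongr
      linarith
    rw [hs.tsum_eq_zero_add]
    simp only [Nat.cast_zero, zero_mul, mul_zero, zero_add, Nat.add_sub_cancel]
    exact tsum_congr fun n => by push_cast; ring
  · rw [norm_mul, norm_mul, norm_pow, Real.norm_eq_abs, Real.norm_eq_abs, Real.norm_eq_abs,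
      Nat.abs_cast]
    have : |y| ≤ R := by simpa using (mem_ball_zero_iff.1 hy).le
    gcongr

/-- After multiplication by n! the convolution becomes a binomial one, bounded by the expansion of
(S + R)^n. -/
theorem FactorialDecay.convolution {a b : ℕ → ℝ} (ha : FactorialDecay a) (hb : FactorialDecay b) :
    FactorialDecay fun n => ∑ ij ∈ antidiagonal n, a ij.1 * b ij.2 := by
  obtain ⟨S, hS, hA⟩ := ha
  obtain ⟨R, hR, hB⟩ := hb
  refine ⟨S + R, by positivity, fun n => ?_⟩
  rw [(Commute.all S R).add_pow']
  refine (mul_le_mul_of_nonneg_right (Finset.abs_sum_le_sum_abs _ _) (by positivity)).trans ?_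
  rw [Finset.sum_mul]
  refine Finset.sum_le_sum fun ij hij => ?_
  rw [HasAntidiagonal.mem_antidiagonal] at hij
  obtain ⟨i, j⟩ := ij
  dsimp only at hij ⊢
  subst hij
  rw [← Nat.add_choose_mul_factorial_mul_factorial, abs_mul, nsmul_eq_mul, Nat.choose_symm_add]
  push_cast
  calc _ = ((i + j).choose j : ℝ) * ((|a i| * i !) * (|b j| * j !)) := by ring
    _ ≤ _ := by gcongr <;> first | exact hA i | exact hB j

theorem FactorialDecay.of_recurrence {a q : ℕ → ℝ} (hq : FactorialDecay q) (h0 : a 0 = 0)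
    (h : ∀ n : ℕ, (n + 1) * a (n + 1) = 2 * a n + q n) : FactorialDecay a := by
  obtain ⟨R, hR, hB⟩ := hq
  -- In the induction step the term 2 a(n) costs 2 (R+3)^n and q(n) costs R^n ≤ (R+3)^n, hence the
  -- 3.
  refine ⟨R + 3, by positivity, fun n => ?_⟩
  induction n with
  | zero => simp [h0]
  | succ n ih =>
    have h1 : |a (n + 1)| * (n + 1) ≤ 2 * |a n| + |q n| := by
      have : |a (n + 1)| * (n + 1) = |2 * a n + q n| := by
        rw [← h n, abs_mul, abs_of_nonneg (by positivity : (0 : ℝ) ≤ n + 1), mul_comm]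
      rw [this]
      refine (abs_add_le _ _).trans ?_
      rw [abs_mul, abs_two]
    have h2 : R ^ n ≤ (R + 3) ^ n := pow_le_pow_left₀ hR (by linarith) n
    have h3 : 0 ≤ R * (R + 3) ^ n := by positivity
    rw [Nat.factorial_succ]
    push_cast
    have h4 := mul_le_mul_of_nonneg_right h1 (show 0 ≤ (n ! : ℝ) by positivity)
    have := hB n
    rw [pow_succ]
    linarith

end PowerSeries

/-! ### The generating functions: convergence, differential equation, integral formulas -/

section GeneratingFunction

theorem factorialDecay_tollSum_dot : FactorialDecay (tollSum dot) :=
  ⟨1, zero_le_one, fun n => by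
    rw [tollSum_dot]
    split_ifs with h
    · simp [h]
    · simp⟩

theorem factorialDecay_compressProb {t : BTree} (ht : IsFull t) :
    FactorialDecay (compressProb t) := by
  refine IsFull.rec_on (p := fun t => FactorialDecay (compressProb t)) ?_ ?_ ht
  · exact factorialDecay_tollSum_dot.of_recurrence (compressProb_zero (by simp))
      (compressProb_succ (by simp))
  · intro l r hl hr ihl ihr
    refine FactorialDecay.of_recurrence ?_ (compressProb_zero (by simp))
      (compressProb_succ (by simp))
    convert! ihl.convolution ihr using 1
    exact funext fun n => tollSum_join hl.ne_nil hr.ne_nil n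

theorem factorialDecay_tollSum {t : BTree} (ht : IsFull t) : FactorialDecay (tollSum t) := by
  refine IsFull.rec_on (p := fun t => FactorialDecay (tollSum t)) factorialDecay_tollSum_dot ?_ ht
  · intro l r hl hr _ _
    convert! (factorialDecay_compressProb hl).convolution (factorialDecay_compressProb hr) using 1
    exact funext fun n => tollSum_join hl.ne_nil hr.ne_nil n

theorem hasSum_numNodes_fiber (n : ℕ) (f : BTree → ℝ) :
    HasSum (fun T : {T : BTree // T.numNodes = n} => f T) (∑ T ∈ treesOfNumNodesEq n, f T) := by
  have : HasSum (f ∘ ((↑) : {T : BTree | T.numNodes = n} → BTree))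
      (∑ T ∈ treesOfNumNodesEq n, f T) := by
    rw [hasSum_subtype_iff_indicator,
      Finset.sum_congr rfl (g := Set.indicator {T : BTree | T.numNodes = n} f)]
    · refine hasSum_sum_of_ne_finset_zero fun T hT => ?_
      rw [mem_treesOfNumNodesEq] at hT
      simp [hT]
    · intro T hT
      rw [mem_treesOfNumNodesEq] at hT
      simp [hT]
  exact this

theorem sum_indicator_compressTo (t : BTree) (x : ℝ) (n : ℕ) :
    ∑ T ∈ treesOfNumNodesEq n,
      (compressTo t).indicator (fun T => bstProb T * x ^ T.numNodes) T =
        compressProb t n * x ^ n := by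
  rw [compressProb, expect, Finset.sum_mul]
  refine Finset.sum_congr rfl fun T hT => ?_
  rw [mem_treesOfNumNodesEq] at hT
  by_cases h : compress T = t <;> simp [compressTo, h, hT]

/-- With |x| in place of x the terms are nonnegative, so they may be grouped by size; each group is
finite and the group sums form an everywhere convergent power series. -/
theorem summable_indicator_compressTo {t : BTree} (ht : IsFull t) (x : ℝ) :
    Summable ((compressTo t).indicator fun T => bstProb T * x ^ T.numNodes) := by
  rw [← summable_abs_iff]
  have habs : (fun T => |(compressTo t).indicator (fun T => bstProb T * x ^ T.numNodes) T|) =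
      (compressTo t).indicator fun T => bstProb T * |x| ^ T.numNodes := by
    funext T
    by_cases h : T ∈ compressTo t <;> simp [h, abs_mul, abs_of_nonneg (bstProb_nonneg T)]
  rw [habs, ← (Equiv.sigmaFiberEquiv BinaryTree.numNodes).summable_iff, summable_sigma_of_nonneg]
  · refine ⟨fun n => (hasSum_numNodes_fiber n _).summable, ?_⟩
    have : ∀ n, ∑' T : {T : BTree // T.numNodes = n},
        (compressTo t).indicator (fun T => bstProb T * |x| ^ T.numNodes) T =
          compressProb t n * |x| ^ n := fun n => by
      rw [(hasSum_numNodes_fiber n _).tsum_eq, sum_indicator_compressTo]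
    exact ((factorialDecay_compressProb ht).summable_norm |x|).of_norm.congr fun n => (this n).symm
  · rintro ⟨n, T⟩
    exact Set.indicator_nonneg (fun T _ => mul_nonneg (bstProb_nonneg T) (by positivity)) _

theorem summable_compressTo {t : BTree} (ht : IsFull t) (x : ℝ) :
    Summable fun T : compressTo t => bstProb T * x ^ (T : BTree).numNodes :=
  summable_subtype_iff_indicator.2 (summable_indicator_compressTo ht x)

theorem G_eq_tsum {t : BTree} (ht : IsFull t) (x : ℝ) :
    G t x = ∑' n : ℕ, compressProb t n * x ^ n := by
  have hs := summable_indicator_compressTo ht x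
  rw [G, tsum_subtype (compressTo t) fun T : BTree => bstProb T * x ^ T.numNodes,
    ← (Equiv.sigmaFiberEquiv BinaryTree.numNodes).tsum_eq]
  refine ((Equiv.sigmaFiberEquiv BinaryTree.numNodes).summable_iff.2 hs).tsum_sigma.trans ?_
  exact tsum_congr fun n =>
    ((hasSum_numNodes_fiber n _).tsum_eq).trans (sum_indicator_compressTo t x n)

theorem G_zero {t : BTree} (ht : IsFull t) : G t 0 = 0 := by
  rw [G_eq_tsum ht, tsum_eq_single 0 fun n hn => by simp [hn], compressProb_zero ht.ne_nil,
    zero_mul]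

theorem hasDerivAt_G {t : BTree} (ht : IsFull t) (x : ℝ) :
    HasDerivAt (G t) (2 * G t x + ∑' n : ℕ, tollSum t n * x ^ n) x := by
  have h := (factorialDecay_compressProb ht).hasDerivAt x
  rw [← funext fun y => G_eq_tsum ht y] at h
  convert! h using 1
  rw [G_eq_tsum ht, ← tsum_mul_left, ← Summable.tsum_add
    (((factorialDecay_compressProb ht).summable_norm x).of_norm.mul_left 2)
    ((factorialDecay_tollSum ht).summable_norm x).of_norm]
  refine tsum_congr fun n => ?_
  rw [compressProb_succ ht.ne_nil]
  ring

theorem continuous_G {t : BTree} (ht : IsFull t) : Continuous (G t) :=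
  continuous_iff_continuousAt.2 fun x => (hasDerivAt_G ht x).continuousAt

theorem tsum_tollSum_join {tL tR : BTree} (hL : IsFull tL) (hR : IsFull tR) (x : ℝ) :
    ∑' n : ℕ, tollSum (join tL tR) n * x ^ n = G tL x * G tR x := by
  rw [G_eq_tsum hL, G_eq_tsum hR, tsum_mul_tsum_eq_tsum_sum_antidiagonal_of_summable_norm
    ((factorialDecay_compressProb hL).summable_norm x)
    ((factorialDecay_compressProb hR).summable_norm x)]
  refine tsum_congr fun n => ?_
  rw [tollSum_join hL.ne_nil hR.ne_nil, Finset.sum_mul]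
  refine Finset.sum_congr rfl fun ij hij => ?_
  rw [HasAntidiagonal.mem_antidiagonal] at hij
  rw [← hij]
  ring

theorem tsum_tollSum_dot (x : ℝ) : ∑' n : ℕ, tollSum dot n * x ^ n = 1 := by
  rw [tsum_eq_single 0 fun n hn => by simp [tollSum_dot, hn]]
  simp [tollSum_dot]

theorem isFull_dot : IsFull dot := by simp [IsFull]

theorem isFull_join {l r : BTree} (hl : IsFull l) (hr : IsFull r) : IsFull (join l r) := by
  cases l with
  | nil => simp [IsFull] at hl
  | node _ a b => exact ⟨hl, hr⟩

/-- Variation of constants for the differential equation of `G t`. -/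
theorem G_eq_integral {t : BTree} (ht : IsFull t) {Q : ℝ → ℝ} (hQ : Continuous Q)
    (hQt : ∀ y, ∑' n : ℕ, tollSum t n * y ^ n = Q y) (x : ℝ) :
    G t x = ∫ y in (0 : ℝ)..x, Q y * Real.exp (2 * (x - y)) := by
  have hd : ∀ y, HasDerivAt (fun y => G t y * Real.exp (2 * (x - y)))
      (Q y * Real.exp (2 * (x - y))) y := by
    intro y
    have h1 := hasDerivAt_G ht y
    have h2 : HasDerivAt (fun y : ℝ => Real.exp (2 * (x - y)))
        (Real.exp (2 * (x - y)) * (2 * (-1))) y :=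
      (((hasDerivAt_id y).const_sub x).const_mul 2).exp
    convert! h1.mul h2 using 1
    rw [hQt]
    ring
  rw [intervalIntegral.integral_eq_sub_of_hasDerivAt (fun y _ => hd y)
    (Continuous.intervalIntegrable (by fun_prop) _ _), G_zero ht]
  simp

theorem G_dot (x : ℝ) : G dot x = (Real.exp (2 * x) - 1) / 2 := by
  rw [G_eq_integral isFull_dot continuous_const tsum_tollSum_dot]
  have hd : ∀ y : ℝ, HasDerivAt (fun y => -(Real.exp (2 * (x - y)) / 2))
      (1 * Real.exp (2 * (x - y))) y := by
    intro y
    have h2 : HasDerivAt (fun y : ℝ => Real.exp (2 * (x - y)))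
        (Real.exp (2 * (x - y)) * (2 * (-1))) y :=
      (((hasDerivAt_id y).const_sub x).const_mul 2).exp
    convert! (h2.div_const 2).neg using 1
    ring
  rw [intervalIntegral.integral_eq_sub_of_hasDerivAt (fun y _ => hd y)
    (Continuous.intervalIntegrable (by fun_prop) _ _)]
  simp
  ring

theorem G_join {tL tR : BTree} (hL : IsFull tL) (hR : IsFull tR) (x : ℝ) :
    G (join tL tR) x = ∫ y in (0 : ℝ)..x, G tL y * G tR y * Real.exp (2 * (x - y)) :=
  G_eq_integral (isFull_join hL hR) ((continuous_G hL).mul (continuous_G hR))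
    (tsum_tollSum_join hL hR) x

theorem tollRate_dot : tollRate (toll dot) = 1 / 3 := by
  rw [tollRate_toll_eq_tsum, tsum_eq_single 0 fun n hn => by simp [tollSum_dot, hn]]
  norm_num [tollSum_dot]

theorem integral_one_sub_sq_mul_pow (n : ℕ) :
    ∫ x in (0 : ℝ)..1, (1 - x) ^ 2 * x ^ n = 2 / (((n : ℝ) + 1) * (n + 2) * (n + 3)) := by
  have h : ∀ x : ℝ, (1 - x) ^ 2 * x ^ n = x ^ n - 2 * x ^ (n + 1) + x ^ (n + 2) := fun x => by
    ring
  simp_rw [h]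
  rw [intervalIntegral.integral_add (Continuous.intervalIntegrable (by fun_prop) _ _)
    (Continuous.intervalIntegrable (by fun_prop) _ _),
    intervalIntegral.integral_sub (Continuous.intervalIntegrable (by fun_prop) _ _)
    (Continuous.intervalIntegrable (by fun_prop) _ _), intervalIntegral.integral_const_mul,
    integral_pow, integral_pow, integral_pow]
  push_cast
  simp only [one_pow, ne_eq, Nat.add_eq_zero_iff, one_ne_zero, and_false, not_false_eq_true,
    zero_pow, sub_zero, add_assoc]
  norm_num
  field_simp
  ring

/-- The weights in the rate are the integrals of (1-x)^2 x^n over [0, 1]. Sum and integral are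
exchanged by dominated convergence, with the summable bound `tollSum t n`. -/
theorem tollRate_eq_integral {t : BTree} (ht : IsFull t) :
    tollRate (toll t) = ∫ x in (0 : ℝ)..1, (1 - x) ^ 2 * ∑' n : ℕ, tollSum t n * x ^ n := by
  rw [tollRate_toll_eq_tsum]
  have hs : Summable (tollSum t) := by
    simpa using ((factorialDecay_tollSum ht).summable_norm 1).of_norm
  have key := intervalIntegral.hasSum_integral_of_dominated_convergence (μ := volume)
    (a := (0 : ℝ)) (b := 1) (F := fun (n : ℕ) x => (1 - x) ^ 2 * (tollSum t n * x ^ n))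
    (f := fun x => (1 - x) ^ 2 * ∑' n : ℕ, tollSum t n * x ^ n) (fun n _ => tollSum t n)
    (fun n => Continuous.aestronglyMeasurable (by fun_prop)) ?_
    (Eventually.of_forall fun _ _ => hs) (by simp) ?_
  · rw [← key.tsum_eq]
    refine tsum_congr fun n => ?_
    rw [← integral_one_sub_sq_mul_pow, ← intervalIntegral.integral_const_mul]
    congr 1
    funext x
    ring
  · refine fun n => Eventually.of_forall fun x hx => ?_
    rw [Set.uIoc_of_le zero_le_one] at hx
    have h0 := tollSum_nonneg t n
    have hx0 := hx.1.le
    rw [Real.norm_of_nonneg (by positivity)]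
    have h1 : (1 - x) ^ 2 ≤ 1 := pow_le_one₀ (by linarith [hx.2]) (by linarith)
    have h2 : x ^ n ≤ 1 := pow_le_one₀ hx0 hx.2
    calc (1 - x) ^ 2 * (tollSum t n * x ^ n) ≤ 1 * (tollSum t n * 1) := by gcongr
      _ = tollSum t n := by ring
  · exact Eventually.of_forall fun x _ =>
      (((factorialDecay_tollSum ht).summable_norm x).of_norm.hasSum).mul_left _

theorem tollRate_join {tL tR : BTree} (hL : IsFull tL) (hR : IsFull tR) :
    tollRate (toll (join tL tR)) = ∫ x in (0 : ℝ)..1, (1 - x) ^ 2 * G tL x * G tR x := by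
  rw [tollRate_eq_integral (isFull_join hL hR)]
  simp_rw [tsum_tollSum_join hL hR, mul_assoc]

end GeneratingFunction

end CompressedBST

theorem mainTheorem3 :
    -- the generating functions converge absolutely everywhere
    (∀ t : CompressedBST.BTree, CompressedBST.IsFull t → ∀ x : ℝ,
      Summable fun T : CompressedBST.compressTo t =>
        CompressedBST.bstProb T * x ^ (T : CompressedBST.BTree).numNodes) ∧
    -- the recursion for the generating functions
    (∀ x : ℝ, CompressedBST.G CompressedBST.dot x = (Real.exp (2 * x) - 1) / 2) ∧
    (∀ tL tR : CompressedBST.BTree, CompressedBST.IsFull tL → CompressedBST.IsFull tR → ∀ x : ℝ,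
      IntervalIntegrable (fun y => CompressedBST.G tL y * CompressedBST.G tR y *
          Real.exp (2 * (x - y))) MeasureTheory.volume 0 x ∧
      CompressedBST.G (CompressedBST.join tL tR) x =
        ∫ y in (0 : ℝ)..x, CompressedBST.G tL y * CompressedBST.G tR y *
          Real.exp (2 * (x - y))) ∧
    -- the fringe tree constants
    CompressedBST.IsFringeConstant CompressedBST.dot (1 / 3) ∧
    (∀ tL tR : CompressedBST.BTree, CompressedBST.IsFull tL → CompressedBST.IsFull tR →
      IntervalIntegrable (fun x => (1 - x) ^ 2 * CompressedBST.G tL x * CompressedBST.G tR x)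
        MeasureTheory.volume 0 1 ∧
      CompressedBST.IsFringeConstant (CompressedBST.join tL tR)
        (∫ x in (0 : ℝ)..1, (1 - x) ^ 2 * CompressedBST.G tL x * CompressedBST.G tR x)) := by
  refine ⟨fun t ht x => CompressedBST.summable_compressTo ht x, CompressedBST.G_dot,
    fun tL tR hL hR x => ⟨?_, CompressedBST.G_join hL hR x⟩, ?_, fun tL tR hL hR => ⟨?_, ?_⟩⟩
  · have hcL := CompressedBST.continuous_G hL
    have hcR := CompressedBST.continuous_G hR
    exact Continuous.intervalIntegrable (by fun_prop) _ _
  · rw [← CompressedBST.tollRate_dot]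
    exact CompressedBST.isFringeConstant_tollRate _
  · have hcL := CompressedBST.continuous_G hL
    have hcR := CompressedBST.continuous_G hR
    exact Continuous.intervalIntegrable (by fun_prop) _ _
  · rw [← CompressedBST.tollRate_join hL hR]
    exact CompressedBST.isFringeConstant_tollRate _
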